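/- **Definitions.** For a poset $P$, $\mathrm{F}_{\mathbf{L}}(P)$ is the free lattice on $P$: it is generated by a copy of $P$, and every order-preserving map from $P$ to a lattice extends uniquely to a lattice homomorphism. The free lattice on a set is the case of an antichain. A lattice congruence is *finitely generated* if it is the least congruence containing some finite set of pairs. A lattice is *finitely defined* if it is defined by a set of generators (of any cardinality) and finitely many relations within the class of all lattices, i.e. it is isomorphic to a quotient of the free lattice on a set by a finitely generated congruence. A lattice homomorphism $f\colon K\to L$ is *lower bounded* if for every $a\in L$ the set $\{x\in K : a\le f(x)\}$ is empty or has a least element. Let $S$ be a join-semilattice and let $a\in S$ be different from the least element of $S$ (if there is one). A *nontrivial join-cover* of $a$ is a finite $X\subseteq S$ with $a\le\bigvee X$ and $a\not\le x$ for all $x\in X$. For finite $X,Y\subseteq S$, $X$ *refines* $Y$ if every element of $X$ lies below an element of $Y$. A nontrivial join-cover $E$ of $a$ is *minimal* if every nontrivial join-cover $X$ of $a$ that refines $E$ contains $E$. The semilattice $S$ has the *minimal join-cover refinement property (MCRP)* if each such $a$ has only finitely many minimal nontrivial join-covers and each nontrivial join-cover of $a$ is refined by a minimal one. A lattice is *algebraic*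 if it is complete and every element is a join of compact elements, and *bi-algebraic* if both it and its order-dual are algebraic. $\operatorname{Id}L$ is the set of all (possibly empty) lower subsets of $L$ closed under binary joins, ordered by inclusion. **Statement.** (1) For every poset $P$ and every finitely generated congruence $\theta$ of $\mathrm{F}_{\mathbf{L}}(P)$, the lattice $\mathrm{F}_{\mathbf{L}}(P)/\theta$ has the MCRP. (2) Let $L$ be a lower bounded homomorphic image of a finitely defined lattice, that is, let there be a surjective lower bounded homomorphism from a finitely defined lattice onto $L$. Then $\operatorname{Id}L$ is bi-algebraic. If $L$ has a least element, then the lattice of all nonempty ideals of $L$ is bi-algebraic as well. -/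

import Mathlib

universe u v w

namespace LatticeTheory

/-! ### The free lattice on a poset -/

/-- Lattice terms with variables in `P`. -/
inductive Term (P : Type u) : Type u
  | var : P → Term P
  | sup : Term P → Term P → Term P
  | inf : Term P → Term P → Term P

/-- The least preorder on lattice terms that extends the order of `P` and for which `sup` and `inf`
are binary suprema and infima: `Term.Le s t` says that `s ≤ t` follows from the order of `P` and
the axioms of lattices. -/
inductive Term.Le {P : Type u} [PartialOrder P] : Term P → Term P → Prop
  | refl (s : Term P) : Term.Le s s
  | trans {r s t : Term P} : Term.Le r s → Term.Le s t → Term.Le r t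
  | var {p q : P} : p ≤ q → Term.Le (Term.var p) (Term.var q)
  | le_sup_left (s t : Term P) : Term.Le s (Term.sup s t)
  | le_sup_right (s t : Term P) : Term.Le t (Term.sup s t)
  | sup_le {r s t : Term P} : Term.Le r t → Term.Le s t → Term.Le (Term.sup r s) t
  | inf_le_left (s t : Term P) : Term.Le (Term.inf s t) s
  | inf_le_right (s t : Term P) : Term.Le (Term.inf s t) t
  | le_inf {r s t : Term P} : Term.Le r s → Term.Le r t → Term.Le r (Term.inf s t)

instance Term.instPreorder {P : Type u} [PartialOrder P] : Preorder (Term P) where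
  le := Term.Le
  le_refl := Term.Le.refl
  le_trans _ _ _ := Term.Le.trans

/-- The free lattice on the poset `P`: lattice terms modulo mutual deducible inequality. -/
def FreeLattice (P : Type u) [PartialOrder P] : Type u :=
  Antisymmetrization (Term P) (· ≤ ·)

namespace FreeLattice

variable {P : Type u} [PartialOrder P]

instance instPartialOrder : PartialOrder (FreeLattice P) :=
  inferInstanceAs (PartialOrder (Antisymmetrization (Term P) (· ≤ ·)))

/-- The element of the free lattice represented by a term. -/
def mk (t : Term P) : FreeLattice P := toAntisymmetrization (· ≤ ·) t

theorem mk_le_mk {s t : Term P} : mk s ≤ mk t ↔ Term.Le s t := Iff.rfl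

theorem mk_surjective : Function.Surjective (mk : Term P → FreeLattice P) :=
  fun x => Quotient.inductionOn' x fun t => ⟨t, rfl⟩

instance instLattice : Lattice (FreeLattice P) where
  sup := Quotient.map₂ Term.sup fun _ _ h _ _ k =>
    ⟨.sup_le (.trans h.1 (.le_sup_left _ _)) (.trans k.1 (.le_sup_right _ _)),
      .sup_le (.trans h.2 (.le_sup_left _ _)) (.trans k.2 (.le_sup_right _ _))⟩
  inf := Quotient.map₂ Term.inf fun _ _ h _ _ k =>
    ⟨.le_inf (.trans (.inf_le_left _ _) h.1) (.trans (.inf_le_right _ _) k.1),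
      .le_inf (.trans (.inf_le_left _ _) h.2) (.trans (.inf_le_right _ _) k.2)⟩
  le_sup_left := by
    intro a b
    obtain ⟨s, rfl⟩ := mk_surjective a
    obtain ⟨t, rfl⟩ := mk_surjective b
    exact Term.Le.le_sup_left s t
  le_sup_right := by
    intro a b
    obtain ⟨s, rfl⟩ := mk_surjective a
    obtain ⟨t, rfl⟩ := mk_surjective b
    exact Term.Le.le_sup_right s t
  sup_le := by
    intro a b c
    obtain ⟨r, rfl⟩ := mk_surjective a
    obtain ⟨s, rfl⟩ := mk_surjective b
    obtain ⟨t, rfl⟩ := mk_surjective c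
    exact Term.Le.sup_le
  inf_le_left := by
    intro a b
    obtain ⟨s, rfl⟩ := mk_surjective a
    obtain ⟨t, rfl⟩ := mk_surjective b
    exact Term.Le.inf_le_left s t
  inf_le_right := by
    intro a b
    obtain ⟨s, rfl⟩ := mk_surjective a
    obtain ⟨t, rfl⟩ := mk_surjective b
    exact Term.Le.inf_le_right s t
  le_inf := by
    intro a b c
    obtain ⟨r, rfl⟩ := mk_surjective a
    obtain ⟨s, rfl⟩ := mk_surjective b
    obtain ⟨t, rfl⟩ := mk_surjective c
    exact Term.Le.le_inf

theorem mk_sup (s t : Term P) : mk (Term.sup s t) = mk s ⊔ mk t := rfl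

theorem mk_inf (s t : Term P) : mk (Term.inf s t) = mk s ⊓ mk t := rfl

/-- The canonical map from `P` to the free lattice on `P`. -/
def of (p : P) : FreeLattice P := mk (Term.var p)

/-- The value of a term in a lattice. -/
def eval {L : Type v} [Lattice L] (f : P → L) : Term P → L
  | Term.var p => f p
  | Term.sup s t => eval f s ⊔ eval f t
  | Term.inf s t => eval f s ⊓ eval f t

theorem eval_le_eval {L : Type v} [Lattice L] {f : P → L} (hf : Monotone f) {s t : Term P}
    (h : Term.Le s t) : eval f s ≤ eval f t := by
  induction h with
  | refl => exact le_rfl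
  | trans _ _ h k => exact h.trans k
  | var h => exact hf h
  | le_sup_left => exact _root_.le_sup_left
  | le_sup_right => exact _root_.le_sup_right
  | sup_le _ _ h k => exact _root_.sup_le h k
  | inf_le_left => exact _root_.inf_le_left
  | inf_le_right => exact _root_.inf_le_right
  | le_inf _ _ h k => exact _root_.le_inf h k

/-- The lattice homomorphism that extends an order-preserving map from `P` to a lattice. -/
def lift {L : Type v} [Lattice L] (f : P → L) (hf : Monotone f) : LatticeHom (FreeLattice P) L where
  toFun := Quotient.lift (eval f) fun _ _ h =>
    le_antisymm (eval_le_eval hf h.1) (eval_le_eval hf h.2)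
  map_sup' a b := by
    obtain ⟨s, rfl⟩ := mk_surjective a
    obtain ⟨t, rfl⟩ := mk_surjective b
    rfl
  map_inf' a b := by
    obtain ⟨s, rfl⟩ := mk_surjective a
    obtain ⟨t, rfl⟩ := mk_surjective b
    rfl

theorem lift_of {L : Type v} [Lattice L] (f : P → L) (hf : Monotone f) (p : P) :
    lift f hf (of p) = f p := rfl

theorem hom_ext {L : Type v} [Lattice L] {g h : LatticeHom (FreeLattice P) L}
    (H : ∀ p, g (of p) = h (of p)) : g = h := by
  ext a
  obtain ⟨t, rfl⟩ := mk_surjective a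
  induction t with
  | var p => exact H p
  | sup s t hs ht => rw [mk_sup, map_sup, map_sup, hs, ht]
  | inf s t hs ht => rw [mk_inf, map_inf, map_inf, hs, ht]

theorem of_le_of {p q : P} : of p ≤ of q ↔ p ≤ q := by
  refine ⟨fun h => ?_, fun h => Term.Le.var h⟩
  have hm : Monotone (LowerSet.Iic : P → LowerSet P) := fun a b hab => LowerSet.Iic_le.2 hab
  have := OrderHomClass.mono (lift LowerSet.Iic hm) h
  rw [lift_of, lift_of, LowerSet.Iic_le] at this
  exact this

end FreeLattice

/-- The set `X` as a poset in which distinct elements are incomparable. The free lattice on this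
poset is the free lattice on the set `X`. -/
def Antichain (X : Type u) : Type u := X

instance Antichain.instPartialOrder (X : Type u) : PartialOrder (Antichain X) where
  le x y := x = y
  le_refl _ := rfl
  le_trans _ _ _ := Eq.trans
  le_antisymm _ _ h _ := h

/-! ### Congruences and quotients -/

/-- The quotient of a lattice by a congruence. -/
def QuotientLattice {L : Type u} [Lattice L] (θ : LatticeCon L) : Type u := Quotient θ.toSetoid

namespace QuotientLattice

variable {L : Type u} [Lattice L] (θ : LatticeCon L)

/-- The class of an element. -/
def mk (x : L) : QuotientLattice θ := Quotient.mk θ.toSetoid x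

theorem mk_surjective : Function.Surjective (mk θ) := Quotient.mk_surjective

theorem mk_eq_mk {x y : L} : mk θ x = mk θ y ↔ θ.r x y := Quotient.eq

instance instMax : Max (QuotientLattice θ) :=
  ⟨Quotient.map₂ (· ⊔ ·) fun _ _ h _ _ k => θ.sup h k⟩

instance instMin : Min (QuotientLattice θ) :=
  ⟨Quotient.map₂ (· ⊓ ·) fun _ _ h _ _ k => θ.inf h k⟩

theorem mk_sup (x y : L) : mk θ (x ⊔ y) = mk θ x ⊔ mk θ y := rfl

theorem mk_inf (x y : L) : mk θ (x ⊓ y) = mk θ x ⊓ mk θ y := rfl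

/-- The operations are computed on representatives; the order is `x ≤ y ↔ x ⊔ y = y`. -/
instance instLattice : Lattice (QuotientLattice θ) :=
  Lattice.mk'
    (by
      intro a b
      obtain ⟨x, rfl⟩ := mk_surjective θ a
      obtain ⟨y, rfl⟩ := mk_surjective θ b
      rw [← mk_sup, ← mk_sup, sup_comm])
    (by
      intro a b c
      obtain ⟨x, rfl⟩ := mk_surjective θ a
      obtain ⟨y, rfl⟩ := mk_surjective θ b
      obtain ⟨z, rfl⟩ := mk_surjective θ c
      simp only [← mk_sup, sup_assoc])
    (by
      intro a b
      obtain ⟨x, rfl⟩ := mk_surjective θ a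
      obtain ⟨y, rfl⟩ := mk_surjective θ b
      rw [← mk_inf, ← mk_inf, inf_comm])
    (by
      intro a b c
      obtain ⟨x, rfl⟩ := mk_surjective θ a
      obtain ⟨y, rfl⟩ := mk_surjective θ b
      obtain ⟨z, rfl⟩ := mk_surjective θ c
      simp only [← mk_inf, inf_assoc])
    (by
      intro a b
      obtain ⟨x, rfl⟩ := mk_surjective θ a
      obtain ⟨y, rfl⟩ := mk_surjective θ b
      rw [← mk_inf, ← mk_sup, sup_inf_self])
    (by
      intro a b
      obtain ⟨x, rfl⟩ := mk_surjective θ a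
      obtain ⟨y, rfl⟩ := mk_surjective θ b
      rw [← mk_sup, ← mk_inf, inf_sup_self])

/-- The canonical projection. -/
def proj : LatticeHom L (QuotientLattice θ) where
  toFun := mk θ
  map_sup' _ _ := rfl
  map_inf' _ _ := rfl

end QuotientLattice

/-- The congruence `θ` is generated by a finite set of pairs, that is, it is the least congruence
that contains them. -/
def IsFinitelyGeneratedCon {L : Type u} [Lattice L] (θ : LatticeCon L) : Prop :=
  ∃ R : Set (L × L), R.Finite ∧ (∀ p ∈ R, θ.r p.1 p.2) ∧
    ∀ ψ : LatticeCon L, (∀ p ∈ R, ψ.r p.1 p.2) → ∀ x y, θ.r x y → ψ.r x y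

/-- The lattice `M` is defined by a set `X` of generators, of any size, and finitely many relations
(within the class of all lattices). -/
def IsFinitelyDefined (M : Type v) [Lattice M] : Prop :=
  ∃ (X : Type w) (θ : LatticeCon (FreeLattice (Antichain X))),
    IsFinitelyGeneratedCon θ ∧ Nonempty (M ≃o QuotientLattice θ)

/-- A lattice homomorphism is lower bounded if the preimage of every principal filter is either
empty or has a least element. -/
def IsLowerBoundedHom {K : Type u} {L : Type v} [Lattice K] [Lattice L] (f : LatticeHom K L) :
    Prop :=
  ∀ a : L, f ⁻¹' Set.Ici a = ∅ ∨ ∃ x, IsLeast (f ⁻¹' Set.Ici a) x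

/-! ### The minimal join-cover refinement property -/

section JoinCovers

variable {S : Type u} [SemilatticeSup S]

/-- `X` refines `Y`: every element of `X` lies below some element of `Y`. -/
def Refines (X Y : Finset S) : Prop := ∀ x ∈ X, ∃ y ∈ Y, x ≤ y

/-- The nontrivial join-covers of `a`. The empty set has a join only if `S` has a zero. -/
def nontrivialJoinCovers (a : S) : Set (Finset S) :=
  {X | (∀ x ∈ X, ¬ a ≤ x) ∧ ∃ s, IsLUB (X : Set S) s ∧ a ≤ s}

/-- The minimal nontrivial join-covers of `a`. -/
def minimalJoinCovers (a : S) : Set (Finset S) :=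
  {E | E ∈ nontrivialJoinCovers a ∧ ∀ X ∈ nontrivialJoinCovers a, Refines X E → E ⊆ X}

end JoinCovers

/-- The minimal join-cover refinement property: every nonzero element has only finitely many minimal
nontrivial join-covers, and each of its nontrivial join-covers is refined by one of them. -/
def HasMCRP (S : Type u) [SemilatticeSup S] : Prop :=
  ∀ a : S, ¬ IsBot a →
    (minimalJoinCovers a).Finite ∧
      ∀ X ∈ nontrivialJoinCovers a, ∃ E ∈ minimalJoinCovers a, Refines E X

/-! ### Ideals and bi-algebraic lattices -/

/-- The ideal lattice of `L`: the (possibly empty) lower subsets of `L` closed under binary joins,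
ordered by inclusion. -/
def Id (L : Type u) [SemilatticeSup L] : Type u :=
  {I : Set L // IsLowerSet I ∧ SupClosed I}

instance Id.instPartialOrder (L : Type u) [SemilatticeSup L] : PartialOrder (Id L) :=
  inferInstanceAs (PartialOrder {I : Set L // IsLowerSet I ∧ SupClosed I})

/-- Every subset of `S` has a join and a meet. -/
def IsCompleteOrder (S : Type u) [PartialOrder S] : Prop :=
  ∀ X : Set S, (∃ s, IsLUB X s) ∧ ∃ i, IsGLB X i

/-- `S` is complete and every element is a join of compact elements. -/
def IsAlgebraicOrder (S : Type u) [PartialOrder S] : Prop :=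
  IsCompleteOrder S ∧ ∀ a : S, ∃ X : Set S, (∀ c ∈ X, IsCompactElement c) ∧ IsLUB X a

/-- `S` is both algebraic and dually algebraic. -/
def IsBialgebraic (S : Type u) [PartialOrder S] : Prop :=
  IsAlgebraicOrder S ∧ IsAlgebraicOrder Sᵒᵈ

end LatticeTheory

/-!
The proof rests on a finiteness property stronger than the MCRP, `IsLocallyCoverFinite`: every
element lies in a finite set `G` that is *cover-closed*, which means that each nontrivial join-cover
of a member of `G` is refined by one inside `G`.

**Quotients of free lattices.** Let `L` be the quotient of `F(P)` by a finitely generated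
congruence, and let `V` be the finite set of values in `L` of the subterms of the relations. Given a
finite set `X` with join `b`, let `N` consist of the elements that lie below an element of `X` or
below the join of `V ∩ ↓X`, and double the convex set `↓b \ N` (`Doubling`). The relations stay
true in the doubled lattice when each generator is sent to its upper copy where it has one, because
`N` is closed under the joins of values of subterms that occur there. So the projection of the
doubled lattice onto `L` has a section `σ` (`exists_section_doubling`). The elements of `X` have
only lower copies, hence `σ` maps `b`, and everything below `b`, to the lower copy. But `σ` maps to
the upper copy all generators and members of `V` outside `N`, and every meet outside `N` of two
elements not below `b`. Hence all such elements fail to be below `b`: this is `le_isLUB_cases`, a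
form of the Whitman and Dean conditions. It yields cover-closed sets by induction on terms
(`isLocallyCoverFinite_quotientLattice`): in effect, covers of generators are refined inside `V`,
covers of joins are put together from those of the joinands, and covers of meets come from the
meetands or from `V`.

**Consequences.** Inside a finite cover-closed set there are only finitely many covers of an
element; the maximal elements of one that is minimal for refinement form a minimal join-cover, which
gives the MCRP. The property passes to the image of a lower bounded surjection `f` with left adjoint
`β`, since a minimal join-cover of an element of the range of `β` consists of elements of that
range. Finally, if every element of `L` lies in a finite cover-closed set and `a` is not in the
ideal `I`, choose such a set `G` containing `a` and put `F = G \ I`. The elements with no member of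
`F` below them form an ideal that contains `I` but not `a`, and it is dually compact because `F` is
finite; so `I` is an intersection of dually compact ideals.
-/

namespace LatticeTheory

/-! ### Join-covers and finite cover-closed sets -/

section JoinCovers

variable {S : Type u} [SemilatticeSup S]

theorem Refines.trans {X Y Z : Finset S} (h : Refines X Y) (k : Refines Y Z) : Refines X Z := by
  intro x hx
  obtain ⟨y, hy, hxy⟩ := h x hx
  obtain ⟨z, hz, hyz⟩ := k y hy
  exact ⟨z, hz, hxy.trans hyz⟩

/-- A finite set that refines a set of elements not above `a` has no elements above `a`. -/
theorem Refines.forall_not_le {X Y : Finset S} {a : S} (h : Refines X Y)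
    (hY : ∀ y ∈ Y, ¬ a ≤ y) : ∀ x ∈ X, ¬ a ≤ x := by
  intro x hx hax
  obtain ⟨y, hy, hxy⟩ := h x hx
  exact hY y hy (hax.trans hxy)

/-- Every nontrivial join-cover of an element of `G` is refined by a nontrivial join-cover of the
same element that consists of elements of `G`. -/
def IsCoverClosed (G : Finset S) : Prop :=
  ∀ g ∈ G, ∀ X ∈ nontrivialJoinCovers g, ∃ E ∈ nontrivialJoinCovers g, E ⊆ G ∧ Refines E X

/-- Every element belongs to a finite cover-closed set. This is stronger than the minimal join-cover
refinement property: the passage from an element to the members of its minimal nontrivial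
join-covers, iterated, reaches only finitely many elements. -/
def IsLocallyCoverFinite (S : Type u) [SemilatticeSup S] : Prop :=
  ∀ a : S, ∃ G : Finset S, a ∈ G ∧ IsCoverClosed G

theorem IsCoverClosed.subset_of_mem_minimalJoinCovers {G : Finset S} (hG : IsCoverClosed G) {g : S}
    (hg : g ∈ G) {E : Finset S} (hE : E ∈ minimalJoinCovers g) : E ⊆ G := by
  obtain ⟨E', hE', hE'G, hr⟩ := hG g hg E hE.1
  exact (hE.2 E' hE' hr).trans hE'G

/-- In a finite set every element lies below a maximal one. -/
theorem refines_filter_maximal (E : Finset S) [DecidablePred fun x => Maximal (· ∈ E) x] :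
    Refines E (E.filter fun x => Maximal (· ∈ E) x) := by
  intro x hx
  obtain ⟨y, hxy, hy⟩ := E.exists_le_maximal hx
  exact ⟨y, Finset.mem_filter.2 ⟨hy.prop, hy⟩, hxy⟩

/-- A subset of `E` that `E` refines has the same upper bounds, so it covers what `E` covers. -/
theorem mem_nontrivialJoinCovers_of_subset {E F : Finset S} {a : S}
    (hE : E ∈ nontrivialJoinCovers a) (hFE : F ⊆ E) (h : Refines E F) :
    F ∈ nontrivialJoinCovers a := by
  obtain ⟨h1, s, hs, has⟩ := hE
  refine ⟨fun x hx => h1 x (hFE hx), s, ⟨fun x hx => hs.1 (hFE hx), fun t ht => hs.2 ?_⟩, has⟩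
  intro x hx
  obtain ⟨y, hy, hxy⟩ := h x hx
  exact hxy.trans (ht hy)

theorem IsCoverClosed.exists_minimalJoinCover {G : Finset S} (hG : IsCoverClosed G) {g : S}
    (hg : g ∈ G) {X : Finset S} (hX : X ∈ nontrivialJoinCovers g) :
    ∃ E ∈ minimalJoinCovers g, Refines E X := by
  classical
  -- Among the covers inside `G` that refine `X`, one with the fewest elements of `G` below it is
  -- minimal for refinement; its maximal elements form a minimal join-cover.
  let down : Finset S → Finset S := fun E => G.filter fun y => ∃ e ∈ E, y ≤ e
  let C : Set (Finset S) := {E | E ∈ nontrivialJoinCovers g ∧ E ⊆ G ∧ Refines E X}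
  have hC : C.Nonempty := hG g hg X hX
  obtain ⟨E, ⟨hE, hEG, hEX⟩, hmin⟩ :
      ∃ E ∈ C, ∀ E' ∈ C, (down E).card ≤ (down E').card :=
    ⟨Function.argminOn (fun E => (down E).card) C hC, Function.argminOn_mem _ _ hC,
      fun E' hE' => Function.argminOn_le (fun E => (down E).card) C hE'⟩
  let E₁ := E.filter fun x => Maximal (· ∈ E) x
  have hE₁E : E₁ ⊆ E := Finset.filter_subset _ _
  have hEE₁ : Refines E E₁ := refines_filter_maximal E
  refine ⟨E₁, ⟨mem_nontrivialJoinCovers_of_subset hE hE₁E hEE₁, fun Y hY hYE => ?_⟩,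
    fun x hx => hEX x (hE₁E hx)⟩
  obtain ⟨E', hE', hE'G, hE'Y⟩ := hG g hg Y hY
  have hE'E : Refines E' E := fun x hx => by
    obtain ⟨z, hz, hxz⟩ := (hE'Y.trans hYE) x hx
    exact ⟨z, hE₁E hz, hxz⟩
  have hsub : down E' ⊆ down E := fun y hy => by
    obtain ⟨hyG, e, he, hye⟩ := Finset.mem_filter.1 hy
    obtain ⟨z, hz, hez⟩ := hE'E e he
    exact Finset.mem_filter.2 ⟨hyG, z, hz, hye.trans hez⟩
  have heq : down E' = down E :=
    Finset.eq_of_subset_of_card_le hsub (hmin E' ⟨hE', hE'G, hE'E.trans hEX⟩)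
  intro e he
  have heE := hE₁E he
  have : e ∈ down E' := heq ▸ Finset.mem_filter.2 ⟨hEG heE, e, heE, le_rfl⟩
  obtain ⟨-, e', he', hee'⟩ := Finset.mem_filter.1 this
  obtain ⟨y, hy, he'y⟩ := hE'Y e' he'
  obtain ⟨z, hz, hyz⟩ := hYE y hy
  have hze : z ≤ e := (Finset.mem_filter.1 he).2.le_of_ge (hE₁E hz) (hee'.trans (he'y.trans hyz))
  rwa [le_antisymm (hee'.trans he'y) (hyz.trans hze)]

theorem IsLocallyCoverFinite.hasMCRP (h : IsLocallyCoverFinite S) : HasMCRP S := by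
  intro a _
  obtain ⟨G, haG, hG⟩ := h a
  refine ⟨(G.powerset.finite_toSet).subset fun E hE => ?_,
    fun X hX => hG.exists_minimalJoinCover haG hX⟩
  exact Finset.mem_coe.2 (Finset.mem_powerset.2 (hG.subset_of_mem_minimalJoinCovers haG hE))

end JoinCovers

/-! ### Lower bounded homomorphic images -/

section LowerBounded

variable {K : Type u} {L : Type v} [Lattice K] [Lattice L]

theorem IsLowerBoundedHom.exists_galoisConnection {f : LatticeHom K L} (hf : IsLowerBoundedHom f)
    (hs : Function.Surjective f) : ∃ β : L → K, GaloisConnection β f := by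
  have h : ∀ a : L, ∃ x, IsLeast (f ⁻¹' Set.Ici a) x := fun a => by
    refine (hf a).resolve_left fun h0 => ?_
    obtain ⟨x, rfl⟩ := hs a
    exact (h0 ▸ (le_rfl : f x ≤ f x) : x ∈ (∅ : Set K))
  choose β hβ using h
  exact ⟨β, fun a x => ⟨fun hx => (hβ a).1.trans (OrderHomClass.mono f hx), fun hx => (hβ a).2 hx⟩⟩

/-- A surjective homomorphism preserves the joins of finite sets, the empty set included. -/
theorem isLUB_image_of_surjective [DecidableEq L] (f : LatticeHom K L) (hs : Function.Surjective f)
    {E : Finset K} {s : K} (h : IsLUB (E : Set K) s) : IsLUB (E.image f : Set L) (f s) := by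
  rcases E.eq_empty_or_nonempty with rfl | hE
  · have hbot : IsBot s := by simpa using h
    have : IsBot (f s) := fun y => by
      obtain ⟨x, rfl⟩ := hs y
      exact OrderHomClass.mono f (hbot x)
    simpa using this
  · have hs' : s = E.sup' hE id := h.unique (Finset.isLUB_sup' hE)
    have h2 : f s = (E.image f).sup' (hE.image f) id := by
      rw [hs', map_finset_sup', Finset.sup'_image]; rfl
    rw [h2]
    exact Finset.isLUB_sup' _

theorem isLocallyCoverFinite_of_lowerBounded (f : LatticeHom K L) (hs : Function.Surjective f)
    (hf : IsLowerBoundedHom f) (hK : IsLocallyCoverFinite K) : IsLocallyCoverFinite L := by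
  classical
  obtain ⟨β, gc⟩ := hf.exists_galoisConnection hs
  have hfβ : ∀ a, f (β a) = a := fun a => by
    obtain ⟨x, rfl⟩ := hs a
    exact gc.u_l_u_eq_u x
  intro a
  obtain ⟨G, haG, hG⟩ := hK (β a)
  refine ⟨(G.filter fun g => β (f g) = g).image f, ?_, ?_⟩
  · exact Finset.mem_image.2 ⟨β a, Finset.mem_filter.2 ⟨haG, by rw [hfβ]⟩, hfβ a⟩
  intro b hb X hX
  obtain ⟨g, hg, rfl⟩ := Finset.mem_image.1 hb
  obtain ⟨hgG, hgβ⟩ := Finset.mem_filter.1 hg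
  obtain ⟨hX1, s, hs1, hs2⟩ := hX
  have hlubβ : IsLUB (X.image β : Set K) (β s) := by
    rw [Finset.coe_image]; exact gc.isLUB_l_image hs1
  have hXβ : X.image β ∈ nontrivialJoinCovers g := by
    refine ⟨fun y hy hgy => ?_, β s, hlubβ, ?_⟩
    · obtain ⟨x, hx, rfl⟩ := Finset.mem_image.1 hy
      exact hX1 x hx (by simpa [hfβ] using OrderHomClass.mono f hgy)
    · rw [← hgβ]; exact gc.monotone_l hs2
  obtain ⟨E, hE, hEX⟩ := hG.exists_minimalJoinCover hgG hXβ
  have hEG := hG.subset_of_mem_minimalJoinCovers hgG hE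
  obtain ⟨t, ht, hgt⟩ := hE.1.2
  have hft : IsLUB (E.image f : Set L) (f t) := isLUB_image_of_surjective f hs ht
  -- Pushing `E` into the range of `β` yields a cover that refines `E`; by minimality of `E` its
  -- elements already are in that range.
  have hEβ : E ⊆ (E.image f).image β := by
    have href : Refines ((E.image f).image β) E := by
      intro y hy
      obtain ⟨_, hx, rfl⟩ := Finset.mem_image.1 hy
      obtain ⟨e, he, rfl⟩ := Finset.mem_image.1 hx
      exact ⟨e, he, gc.l_u_le e⟩
    refine hE.2 _ ⟨href.forall_not_le hE.1.1, β (f t), ?_, ?_⟩ href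
    · rw [Finset.coe_image]; exact gc.isLUB_l_image hft
    · rw [← hgβ]; exact gc.monotone_l (OrderHomClass.mono f hgt)
  have href : Refines (E.image f) X := by
    intro y hy
    obtain ⟨e, he, rfl⟩ := Finset.mem_image.1 hy
    obtain ⟨y, hy, hey⟩ := hEX e he
    obtain ⟨x, hx, rfl⟩ := Finset.mem_image.1 hy
    exact ⟨x, hx, by simpa [hfβ] using OrderHomClass.mono f hey⟩
  refine ⟨E.image f, ⟨href.forall_not_le hX1, f t, hft, OrderHomClass.mono f hgt⟩, ?_, href⟩
  refine Finset.image_subset_image fun e he => Finset.mem_filter.2 ⟨hEG he, ?_⟩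
  obtain ⟨y, -, rfl⟩ := Finset.mem_image.1 (hEβ he)
  rw [hfβ]

end LowerBounded

/-! ### Lattices of ideals -/

theorem _root_.DirectedOn.exists_forall_mem_finset_le {α : Type u} {ι : Type v} [Preorder α]
    {D : Set α} (hD : DirectedOn (· ≤ ·) D) (hne : D.Nonempty) (F : Finset ι) {f : ι → α}
    (hf : ∀ i ∈ F, f i ∈ D) : ∃ m ∈ D, ∀ i ∈ F, f i ≤ m := by
  classical
  induction F using Finset.induction_on with
  | empty => exact hne.imp fun m hm => ⟨hm, by simp⟩
  | insert i F _ ih =>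
    obtain ⟨m, hm, hmF⟩ := ih fun k hk => hf k (Finset.mem_insert_of_mem hk)
    obtain ⟨n, hn, hmn, hin⟩ := hD m hm (f i) (hf i (Finset.mem_insert_self i F))
    refine ⟨n, hn, fun k hk => ?_⟩
    rcases Finset.mem_insert.1 hk with rfl | hk
    · exact hin
    · exact (hmF k hk).trans hmn

section Ideals

variable {L : Type u} [SemilatticeSup L] {Λ : Type v} [PartialOrder Λ] {Z : Set L}

/-- The ordered set `Λ` is a copy, through `c`, of the family of all ideals of `L` (closed under
binary joins, possibly empty) that contain `Z`. The set `Z` is made of least elements, so it is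
empty or a singleton: the first choice yields `Id L`, the second the nonempty ideals. -/
structure IsIdealFamily (Z : Set L) (c : Λ ↪o Set L) : Prop where
  isBot : ∀ z ∈ Z, IsBot z
  range_eq : Set.range c = {I | IsLowerSet I ∧ SupClosed I ∧ Z ⊆ I}

namespace IsIdealFamily

variable {c : Λ ↪o Set L}

theorem exists_eq (h : IsIdealFamily Z c) {I : Set L} (h1 : IsLowerSet I) (h2 : SupClosed I)
    (h3 : Z ⊆ I) : ∃ x, c x = I := by
  have : I ∈ Set.range c := by rw [h.range_eq]; exact ⟨h1, h2, h3⟩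
  exact this

theorem isLowerSet (h : IsIdealFamily Z c) (x : Λ) : IsLowerSet (c x) :=
  ((h.range_eq ▸ Set.mem_range_self x :) : c x ∈ {I | IsLowerSet I ∧ SupClosed I ∧ Z ⊆ I}).1

theorem supClosed (h : IsIdealFamily Z c) (x : Λ) : SupClosed (c x) :=
  ((h.range_eq ▸ Set.mem_range_self x :) : c x ∈ {I | IsLowerSet I ∧ SupClosed I ∧ Z ⊆ I}).2.1

theorem subset (h : IsIdealFamily Z c) (x : Λ) : Z ⊆ c x :=
  ((h.range_eq ▸ Set.mem_range_self x :) : c x ∈ {I | IsLowerSet I ∧ SupClosed I ∧ Z ⊆ I}).2.2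

/-- Intersections of ideals are ideals. -/
theorem exists_isGLB (h : IsIdealFamily Z c) (X : Set Λ) :
    ∃ i, IsGLB X i ∧ c i = ⋂ x ∈ X, c x := by
  obtain ⟨i, hi⟩ := h.exists_eq (I := ⋂ x ∈ X, c x)
    (isLowerSet_iInter₂ fun x _ => h.isLowerSet x)
    (fun a ha b hb => Set.mem_iInter₂.2 fun x hx =>
      h.supClosed x (Set.mem_iInter₂.1 ha x hx) (Set.mem_iInter₂.1 hb x hx))
    (Set.subset_iInter₂ fun x _ => h.subset x)
  refine ⟨i, ⟨fun x hx => ?_, fun y hy => ?_⟩, hi⟩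
  · rw [← c.le_iff_le, hi]; exact Set.biInter_subset_of_mem hx
  · rw [← c.le_iff_le, hi]; exact Set.subset_iInter₂ fun x hx => c.monotone (hy hx)

theorem isCompleteOrder (h : IsIdealFamily Z c) : IsCompleteOrder Λ := by
  refine fun X => ⟨?_, (h.exists_isGLB X).imp fun _ hi => hi.1⟩
  obtain ⟨s, hs, -⟩ := h.exists_isGLB (upperBounds X)
  exact ⟨s, isGLB_upperBounds.1 hs⟩

theorem exists_principal (h : IsIdealFamily Z c) (a : L) : ∃ x, c x = Set.Iic a :=
  h.exists_eq (isLowerSet_Iic a) (fun _ hx _ hy => sup_le hx hy) fun z hz => h.isBot z hz a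

theorem isCompactElement_of_eq_Iic (h : IsIdealFamily Z c) {x : Λ} {a : L} (hx : c x = Set.Iic a) :
    IsCompactElement x := by
  intro D u hne hD hu hxu
  -- A directed union of ideals is an ideal.
  obtain ⟨y, hy⟩ := h.exists_eq (I := ⋃ d ∈ D, c d)
    (isLowerSet_iUnion₂ fun d _ => h.isLowerSet d)
    (fun p hp q hq => by
      obtain ⟨d, hd, hp⟩ := Set.mem_iUnion₂.1 hp
      obtain ⟨e, he, hq⟩ := Set.mem_iUnion₂.1 hq
      obtain ⟨k, hk, hdk, hek⟩ := hD d hd e he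
      exact Set.mem_iUnion₂.2
        ⟨k, hk, h.supClosed k (c.monotone hdk hp) (c.monotone hek hq)⟩)
    (fun z hz => by
      obtain ⟨d, hd⟩ := hne
      exact Set.mem_iUnion₂.2 ⟨d, hd, h.subset d hz⟩)
  have huy : u ≤ y := hu.2 fun d hd => by
    rw [← c.le_iff_le, hy]; exact Set.subset_biUnion_of_mem hd
  have ha : a ∈ c y := c.monotone (hxu.trans huy) (hx ▸ Set.mem_Iic.2 le_rfl)
  rw [hy] at ha
  obtain ⟨d, hd, had⟩ := Set.mem_iUnion₂.1 ha
  refine ⟨d, hd, ?_⟩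
  rw [← c.le_iff_le, hx]
  exact fun b hb => h.isLowerSet d hb had

theorem isAlgebraicOrder (h : IsIdealFamily Z c) : IsAlgebraicOrder Λ := by
  refine ⟨h.isCompleteOrder, fun i => ⟨{x | x ≤ i ∧ ∃ a, c x = Set.Iic a}, ?_, fun x hx => hx.1,
    fun y hy => ?_⟩⟩
  · rintro x ⟨-, a, hx⟩
    exact h.isCompactElement_of_eq_Iic hx
  · rw [← c.le_iff_le]
    intro a ha
    obtain ⟨x, hx⟩ := h.exists_principal a
    have hxi : x ≤ i := by
      rw [← c.le_iff_le, hx]; exact fun b hb => h.isLowerSet i hb ha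
    exact c.monotone (hy ⟨hxi, a, hx⟩) (hx ▸ Set.mem_Iic.2 le_rfl)

/-- A largest ideal among those that avoid a finite set `F` is dually compact: if no member of a
downward directed family of ideals lies below it, then every member contains an element of `F`, and
by directedness some element of `F` belongs to all of them. -/
theorem isCompactElement_toDual (h : IsIdealFamily Z c) {j : Λ} (F : Finset L)
    (hj : c j = {y | ∀ f ∈ F, ¬ f ≤ y}) : IsCompactElement (OrderDual.toDual j) := by
  classical
  intro D u hne hD hu hju
  by_contra! hno
  have key : ∀ d ∈ D, ∃ f ∈ F, f ∈ c (OrderDual.ofDual d) := by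
    intro d hd
    by_contra! hF
    refine hno d hd ?_
    change OrderDual.ofDual d ≤ j
    rw [← c.le_iff_le, hj]
    exact fun y hy f hf hfy => hF f hf (h.isLowerSet _ hfy hy)
  obtain ⟨f, hf, hfD⟩ : ∃ f ∈ F, ∀ d ∈ D, f ∈ c (OrderDual.ofDual d) := by
    by_contra! hF
    have : Nonempty Λᵒᵈ := hne.nonempty
    choose! d hdD hd using hF
    obtain ⟨m, hm, hmd⟩ := hD.exists_forall_mem_finset_le hne F (f := d) hdD
    obtain ⟨f, hf, hfm⟩ := key m hm
    exact hd f hf (c.monotone (hmd f hf) hfm)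
  obtain ⟨i, hi, hic⟩ := h.exists_isGLB (OrderDual.toDual ⁻¹' D)
  have hui : i ≤ OrderDual.ofDual u :=
    hu.2 (show OrderDual.toDual i ∈ upperBounds D from fun d hd => hi.1 hd)
  have hfi : f ∈ c i := by rw [hic]; exact Set.mem_iInter₂.2 fun d hd => hfD _ hd
  have hfj : f ∈ c j := c.monotone (hui.trans hju) hfi
  rw [hj] at hfj
  exact hfj f hf le_rfl

/-- An ideal and an element `a` outside it are separated by an ideal that is the largest one
avoiding a finite set `F`: the elements outside the given ideal of a finite cover-closed set that
contains `a`. -/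
theorem exists_separating (h : IsIdealFamily Z c) (hL : IsLocallyCoverFinite L) (i : Λ) {a : L}
    (ha : a ∉ c i) : ∃ (j : Λ) (F : Finset L), i ≤ j ∧ a ∉ c j ∧ c j = {y | ∀ f ∈ F, ¬ f ≤ y} := by
  classical
  obtain ⟨G, haG, hG⟩ := hL a
  let F := G.filter fun g => g ∉ c i
  have hiF : ∀ y ∈ c i, ∀ f ∈ F, ¬ f ≤ y := fun y hy f hf hfy =>
    (Finset.mem_filter.1 hf).2 (h.isLowerSet i hfy hy)
  obtain ⟨j, hj⟩ := h.exists_eq (I := {y | ∀ f ∈ F, ¬ f ≤ y})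
    (fun y x hxy hy f hf hfx => hy f hf (hfx.trans hxy))
    (by
      intro y hy z hz f hf hfyz
      obtain ⟨hfG, hfi⟩ := Finset.mem_filter.1 hf
      have hX : ({y, z} : Finset L) ∈ nontrivialJoinCovers f := by
        refine ⟨?_, y ⊔ z, ?_, hfyz⟩
        · simp only [Finset.mem_insert, Finset.mem_singleton, forall_eq_or_imp, forall_eq]
          exact ⟨hy f hf, hz f hf⟩
        · rw [Finset.coe_pair]; exact isLUB_pair
      obtain ⟨E, ⟨-, s, hs, hfs⟩, hEG, hEX⟩ := hG f hfG _ hX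
      -- If `E` were inside the ideal, so would be `f`; the empty cover is possible only below
      -- every element.
      have : ∃ e ∈ E, e ∉ c i := by
        by_contra! hE
        rcases E.eq_empty_or_nonempty with rfl | hne
        · have hbot : IsBot s := by simpa using hs
          exact hy f hf (hfs.trans (hbot y))
        · have hsi : s ∈ c i := by
            rw [hs.unique (Finset.isLUB_sup' hne)]
            exact (h.supClosed i).finsetSup'_mem hne fun e he => hE e he
          exact hfi (h.isLowerSet i hfs hsi)
      obtain ⟨e, he, hei⟩ := this
      have heF : e ∈ F := Finset.mem_filter.2 ⟨hEG he, hei⟩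
      obtain ⟨x, hx, hex⟩ := hEX e he
      simp only [Finset.mem_insert, Finset.mem_singleton] at hx
      rcases hx with rfl | rfl
      · exact hy e heF hex
      · exact hz e heF hex)
    (fun z hz => hiF z (h.subset i hz))
  refine ⟨j, F, ?_, ?_, hj⟩
  · rw [← c.le_iff_le, hj]; exact hiF
  · rw [hj]; exact fun haj => haj a (Finset.mem_filter.2 ⟨haG, ha⟩) le_rfl

theorem isBialgebraic (h : IsIdealFamily Z c) (hL : IsLocallyCoverFinite L) :
    IsBialgebraic Λ := by
  refine ⟨h.isAlgebraicOrder, fun X => ?_, fun i => ?_⟩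
  · obtain ⟨⟨s, hs⟩, t, ht⟩ := h.isCompleteOrder (OrderDual.toDual ⁻¹' X)
    exact ⟨⟨OrderDual.toDual t, fun x hx => ht.1 hx, fun y hy => ht.2 fun x hx => hy hx⟩,
      OrderDual.toDual s, fun x hx => hs.1 hx, fun y hy => hs.2 fun x hx => hy hx⟩
  · refine ⟨{x | x ≤ i ∧ IsCompactElement x}, fun x hx => hx.2, fun x hx => hx.1, fun y hy => ?_⟩
    change OrderDual.ofDual y ≤ OrderDual.ofDual i
    rw [← c.le_iff_le]
    intro a hay
    by_contra hai
    obtain ⟨j, F, hij, haj, hj⟩ := h.exists_separating hL (OrderDual.ofDual i) hai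
    have : OrderDual.ofDual y ≤ j :=
      hy (a := OrderDual.toDual j) ⟨hij, h.isCompactElement_toDual F hj⟩
    exact haj (c.monotone this hay)

end IsIdealFamily

theorem isIdealFamily_id (L : Type u) [SemilatticeSup L] :
    IsIdealFamily (∅ : Set L) (Λ := Id L)
      (OrderEmbedding.subtype fun I : Set L => IsLowerSet I ∧ SupClosed I) where
  isBot _ hz := hz.elim
  range_eq := by
    ext I
    exact ⟨fun ⟨x, hx⟩ => hx ▸ ⟨x.2.1, x.2.2, Set.empty_subset _⟩,
      fun hI => ⟨⟨I, hI.1, hI.2.1⟩, rfl⟩⟩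

theorem isIdealFamily_orderIdeal {L : Type u} [SemilatticeSup L] {z : L} (hz : IsBot z) :
    IsIdealFamily {z} (Λ := Order.Ideal L)
      (OrderEmbedding.ofMapLEIff (fun I => (I : Set L)) fun _ _ => Iff.rfl) where
  isBot := by rintro _ rfl; exact hz
  range_eq := by
    ext I
    constructor
    · rintro ⟨x, rfl⟩
      obtain ⟨y, hy⟩ := x.nonempty
      refine ⟨x.lower, fun a ha b hb => Order.Ideal.sup_mem ha hb, ?_⟩
      exact Set.singleton_subset_iff.2 (x.lower (hz y) hy)
    · rintro ⟨h1, h2, h3⟩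
      exact ⟨⟨⟨I, h1⟩, ⟨z, h3 rfl⟩, h2.directedOn⟩, rfl⟩

end Ideals

/-! ### Doubling a convex subset -/

section Doubling

variable {L : Type u} [Lattice L]

/-- Day's doubling of the convex set of all `x ≤ b` outside the lower set `N` of elements below `b`.
The second component tells the upper copy from the lower one; elements of `N` have only a lower
copy, elements not below `b` only an upper one. -/
def Doubling (N : LowerSet L) (b : L) (_ : ∀ x ∈ N, x ≤ b) : Type u :=
  {p : L × Prop // (p.2 → p.1 ∉ N) ∧ (¬ p.2 → p.1 ≤ b)}

namespace Doubling

variable {N : LowerSet L} {b : L} {h : ∀ x ∈ N, x ≤ b}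

instance instPartialOrder : PartialOrder (Doubling N b h) :=
  inferInstanceAs (PartialOrder {p : L × Prop // (p.2 → p.1 ∉ N) ∧ (¬ p.2 → p.1 ≤ b)})

/-- The projection to the original lattice. -/
def val (x : Doubling N b h) : L := x.1.1

/-- The element belongs to the upper copy. -/
def IsUpper (x : Doubling N b h) : Prop := x.1.2

theorem IsUpper.val_notMem {x : Doubling N b h} (hx : x.IsUpper) : x.val ∉ N := x.2.1 hx

theorem val_le_of_not_isUpper {x : Doubling N b h} (hx : ¬ x.IsUpper) : x.val ≤ b := x.2.2 hx

/-- Joins are computed componentwise. Meets are, too, except that a meet that falls into `N` drops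
to the lower copy. -/
instance instLattice : Lattice (Doubling N b h) where
  sup x y := ⟨(x.val ⊔ y.val, x.IsUpper ∨ y.IsUpper),
    fun hu hN => hu.elim (fun hx => hx.val_notMem (N.lower le_sup_left hN))
      fun hy => hy.val_notMem (N.lower le_sup_right hN),
    fun hu => sup_le (val_le_of_not_isUpper fun hx => hu (Or.inl hx))
      (val_le_of_not_isUpper fun hy => hu (Or.inr hy))⟩
  inf x y := ⟨(x.val ⊓ y.val, x.IsUpper ∧ y.IsUpper ∧ x.val ⊓ y.val ∉ N),
    fun hu => hu.2.2,
    fun hu => by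
      by_cases hx : x.IsUpper
      · by_cases hy : y.IsUpper
        · by_contra hb
          exact hu ⟨hx, hy, fun hN => hb (h _ hN)⟩
        · exact inf_le_right.trans (val_le_of_not_isUpper hy)
      · exact inf_le_left.trans (val_le_of_not_isUpper hx)⟩
  le_sup_left _ _ := ⟨le_sup_left, Or.inl⟩
  le_sup_right _ _ := ⟨le_sup_right, Or.inr⟩
  sup_le _ _ _ hx hy := ⟨sup_le hx.1 hy.1, fun hu => hu.elim hx.2 hy.2⟩
  inf_le_left _ _ := ⟨inf_le_left, fun hu => hu.1⟩
  inf_le_right _ _ := ⟨inf_le_right, fun hu => hu.2.1⟩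
  le_inf x _ _ hy hz := ⟨le_inf hy.1 hz.1, fun hu =>
    ⟨hy.2 hu, hz.2 hu, fun hN => x.2.1 hu (N.lower (le_inf hy.1 hz.1) hN)⟩⟩

theorem isUpper_sup {x y : Doubling N b h} : (x ⊔ y).IsUpper ↔ x.IsUpper ∨ y.IsUpper := Iff.rfl

theorem isUpper_inf {x y : Doubling N b h} :
    (x ⊓ y).IsUpper ↔ x.IsUpper ∧ y.IsUpper ∧ x.val ⊓ y.val ∉ N := Iff.rfl

theorem ext_iff {x y : Doubling N b h} : x = y ↔ x.val = y.val ∧ (x.IsUpper ↔ y.IsUpper) :=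
  ⟨fun e => e ▸ ⟨rfl, Iff.rfl⟩, fun e => Subtype.ext (Prod.ext e.1 (propext e.2))⟩

variable (N b h) in
/-- The projection to the original lattice, as a homomorphism. -/
def valHom : LatticeHom (Doubling N b h) L where
  toFun := val
  map_sup' _ _ := rfl
  map_inf' _ _ := rfl

/-- The highest copy of `x`: the upper one unless `x` belongs to `N`. -/
def top (x : L) : Doubling N b h :=
  ⟨(x, x ∉ N), id, fun hx => h x (not_not.1 hx)⟩

theorem top_monotone : Monotone (top : L → Doubling N b h) :=
  fun _ _ hxy => ⟨hxy, fun hx hy => hx (N.lower hxy hy)⟩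

end Doubling

end Doubling

/-! ### Finitely generated congruences of free lattices -/

/-- The set of subterms of a term. -/
def Term.subterms {P : Type u} : Term P → Set (Term P)
  | Term.var p => {Term.var p}
  | Term.sup s t => insert (Term.sup s t) (subterms s ∪ subterms t)
  | Term.inf s t => insert (Term.inf s t) (subterms s ∪ subterms t)

/-- A set of terms closed under subterms. -/
structure IsSubtermClosed {P : Type u} (T : Set (Term P)) : Prop where
  of_sup : ∀ {s t}, Term.sup s t ∈ T → s ∈ T ∧ t ∈ T
  of_inf : ∀ {s t}, Term.inf s t ∈ T → s ∈ T ∧ t ∈ T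

theorem Term.self_mem_subterms {P : Type u} (t : Term P) : t ∈ t.subterms := by
  cases t <;> simp [Term.subterms]

theorem Term.finite_subterms {P : Type u} (t : Term P) : t.subterms.Finite := by
  induction t with
  | var p => exact Set.finite_singleton _
  | sup s t hs ht => exact (hs.union ht).insert _
  | inf s t hs ht => exact (hs.union ht).insert _

theorem Term.isSubtermClosed_subterms {P : Type u} (t : Term P) : IsSubtermClosed t.subterms := by
  induction t with
  | var p => constructor <;> simp [Term.subterms]
  | sup s t hs ht =>
    have h1 := s.self_mem_subterms
    have h2 := t.self_mem_subterms
    obtain ⟨_, _⟩ := hs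
    obtain ⟨_, _⟩ := ht
    constructor <;> simp only [Term.subterms, Set.mem_insert_iff, Set.mem_union] <;> grind
  | inf s t hs ht =>
    have h1 := s.self_mem_subterms
    have h2 := t.self_mem_subterms
    obtain ⟨_, _⟩ := hs
    obtain ⟨_, _⟩ := ht
    constructor <;> simp only [Term.subterms, Set.mem_insert_iff, Set.mem_union] <;> grind

/-- The congruence `θ` is generated by those of its pairs that are represented by terms from `T`. -/
def IsGeneratedBy {P : Type u} [PartialOrder P] (θ : LatticeCon (FreeLattice P))
    (T : Set (Term P)) : Prop :=
  ∀ ψ : LatticeCon (FreeLattice P),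
    (∀ s ∈ T, ∀ t ∈ T, θ.r (FreeLattice.mk s) (FreeLattice.mk t) →
      ψ.r (FreeLattice.mk s) (FreeLattice.mk t)) → ∀ x y, θ.r x y → ψ.r x y

theorem IsFinitelyGeneratedCon.exists_terms {P : Type u} [PartialOrder P]
    {θ : LatticeCon (FreeLattice P)} (h : IsFinitelyGeneratedCon θ) :
    ∃ T : Set (Term P), T.Finite ∧ IsSubtermClosed T ∧ IsGeneratedBy θ T := by
  obtain ⟨R, hR, hRθ, hmin⟩ := h
  choose rep hrep using (FreeLattice.mk_surjective : Function.Surjective (FreeLattice.mk (P := P)))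
  refine ⟨⋃ p ∈ R, ((rep p.1).subterms ∪ (rep p.2).subterms), ?_, ?_, ?_⟩
  · exact hR.biUnion fun p _ => (Term.finite_subterms _).union (Term.finite_subterms _)
  · constructor
    · intro s t hst
      obtain ⟨p, hp, hst⟩ := Set.mem_iUnion₂.1 hst
      rcases hst with hst | hst
      · have := (rep p.1).isSubtermClosed_subterms.of_sup hst
        exact ⟨Set.mem_iUnion₂.2 ⟨p, hp, .inl this.1⟩, Set.mem_iUnion₂.2 ⟨p, hp, .inl this.2⟩⟩
      · have := (rep p.2).isSubtermClosed_subterms.of_sup hst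
        exact ⟨Set.mem_iUnion₂.2 ⟨p, hp, .inr this.1⟩, Set.mem_iUnion₂.2 ⟨p, hp, .inr this.2⟩⟩
    · intro s t hst
      obtain ⟨p, hp, hst⟩ := Set.mem_iUnion₂.1 hst
      rcases hst with hst | hst
      · have := (rep p.1).isSubtermClosed_subterms.of_inf hst
        exact ⟨Set.mem_iUnion₂.2 ⟨p, hp, .inl this.1⟩, Set.mem_iUnion₂.2 ⟨p, hp, .inl this.2⟩⟩
      · have := (rep p.2).isSubtermClosed_subterms.of_inf hst
        exact ⟨Set.mem_iUnion₂.2 ⟨p, hp, .inr this.1⟩, Set.mem_iUnion₂.2 ⟨p, hp, .inr this.2⟩⟩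
  · intro ψ hψ
    refine hmin ψ fun p hp => ?_
    have := hψ (rep p.1) (Set.mem_iUnion₂.2 ⟨p, hp, .inl (Term.self_mem_subterms _)⟩) (rep p.2)
      (Set.mem_iUnion₂.2 ⟨p, hp, .inr (Term.self_mem_subterms _)⟩)
    rw [hrep, hrep] at this
    exact this (hRθ p hp)

/-- A homomorphism whose kernel contains `θ` factors through the quotient by `θ`. -/
def QuotientLattice.lift {K : Type u} {M : Type v} [Lattice K] [Lattice M] (θ : LatticeCon K)
    (g : LatticeHom K M) (hg : ∀ x y, θ.r x y → g x = g y) : LatticeHom (QuotientLattice θ) M where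
  toFun := Quotient.lift g hg
  map_sup' a b := by
    obtain ⟨x, rfl⟩ := mk_surjective θ a
    obtain ⟨y, rfl⟩ := mk_surjective θ b
    exact map_sup g x y
  map_inf' a b := by
    obtain ⟨x, rfl⟩ := mk_surjective θ a
    obtain ⟨y, rfl⟩ := mk_surjective θ b
    exact map_inf g x y

section FinitelyGenerated

variable {P : Type u} [PartialOrder P] (θ : LatticeCon (FreeLattice P))

/-- The value of a term in a quotient of the free lattice. -/
def value (t : Term P) : QuotientLattice θ := QuotientLattice.mk θ (FreeLattice.mk t)

theorem value_surjective : Function.Surjective (value θ) := fun a => by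
  obtain ⟨x, rfl⟩ := QuotientLattice.mk_surjective θ a
  obtain ⟨t, rfl⟩ := FreeLattice.mk_surjective x
  exact ⟨t, rfl⟩

theorem value_sup (s t : Term P) : value θ (Term.sup s t) = value θ s ⊔ value θ t := rfl

theorem value_inf (s t : Term P) : value θ (Term.inf s t) = value θ s ⊓ value θ t := rfl

/-- If `N` contains the join of any two of its elements that are values of terms of `T`, then
sending the generators to their highest copies in the doubling respects the relations, as every
value of a term of `T` goes to its highest copy. -/
theorem exists_section_doubling {T : Set (Term P)} (hT : IsSubtermClosed T)
    (hθ : IsGeneratedBy θ T) {N : LowerSet (QuotientLattice θ)} {b : QuotientLattice θ}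
    (h : ∀ x ∈ N, x ≤ b)
    (hN : ∀ s ∈ T, ∀ t ∈ T, value θ s ∈ N → value θ t ∈ N → value θ s ⊔ value θ t ∈ N) :
    ∃ σ : LatticeHom (QuotientLattice θ) (Doubling N b h), (∀ a, (σ a).val = a) ∧
      (∀ p, (σ (value θ (Term.var p))).IsUpper ↔ value θ (Term.var p) ∉ N) ∧
      ∀ t ∈ T, (σ (value θ t)).IsUpper ↔ value θ t ∉ N := by
  have hmono : Monotone fun p : P => value θ (Term.var p) := fun p q hpq =>
    OrderHomClass.mono (QuotientLattice.proj θ) (FreeLattice.of_le_of.2 hpq)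
  let g : LatticeHom (FreeLattice P) (Doubling N b h) :=
    FreeLattice.lift _ (Doubling.top_monotone.comp hmono)
  have hgval : ∀ x, (g x).val = QuotientLattice.mk θ x := by
    have : (Doubling.valHom N b h).comp g = QuotientLattice.proj θ :=
      FreeLattice.hom_ext fun p => rfl
    exact fun x => DFunLike.congr_fun this x
  have hgT : ∀ t ∈ T, (g (FreeLattice.mk t)).IsUpper ↔ value θ t ∉ N := by
    intro t
    induction t with
    | var p => exact fun _ => Iff.rfl
    | sup s t hs ht =>
      intro hst
      obtain ⟨hsT, htT⟩ := hT.of_sup hst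
      rw [FreeLattice.mk_sup, map_sup, Doubling.isUpper_sup, hs hsT, ht htT, value_sup]
      constructor
      · rintro (h1 | h1) h2
        · exact h1 (N.lower le_sup_left h2)
        · exact h1 (N.lower le_sup_right h2)
      · intro h1
        by_contra! h2
        exact h1 (hN s hsT t htT h2.1 h2.2)
    | inf s t hs ht =>
      intro hst
      obtain ⟨hsT, htT⟩ := hT.of_inf hst
      rw [FreeLattice.mk_inf, map_inf, Doubling.isUpper_inf, hs hsT, ht htT, hgval, hgval,
        value_inf]
      exact ⟨fun h1 => h1.2.2, fun h1 => ⟨fun h2 => h1 (N.lower inf_le_left h2),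
        fun h2 => h1 (N.lower inf_le_right h2), h1⟩⟩
  have hg : ∀ x y, θ.r x y → g x = g y := by
    refine hθ (LatticeCon.ker g) fun s hs t ht hst => ?_
    have hv : value θ s = value θ t := (QuotientLattice.mk_eq_mk θ).2 hst
    refine Doubling.ext_iff.2 ⟨?_, ?_⟩
    · rw [hgval, hgval]; exact hv
    · rw [hgT s hs, hgT t ht, hv]
  refine ⟨QuotientLattice.lift θ g hg, fun a => ?_, fun p => Iff.rfl, hgT⟩
  obtain ⟨x, rfl⟩ := QuotientLattice.mk_surjective θ a
  exact hgval x

/-- The solution of the word problem, in the form needed for join-covers. Let `b` be the join of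
`X`. An element `y ≤ b` that is a generator, or the value of a term of `T`, or a meet of two
elements not below `b`, lies below an element of `X` or below the join of those values of terms of
`T` that lie below elements of `X`. -/
theorem le_isLUB_cases {T : Set (Term P)} (hT : IsSubtermClosed T) (hθ : IsGeneratedBy θ T)
    {X A : Finset (QuotientLattice θ)} {b : QuotientLattice θ}
    (hA : ∀ a, (a ∈ A ↔ ∃ t ∈ T, value θ t = a ∧ ∃ x ∈ X, a ≤ x))
    (hb : IsLUB (X : Set (QuotientLattice θ)) b) :
    (∀ t, (t ∈ T ∨ ∃ p, t = Term.var p) → value θ t ≤ b →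
      (∃ x ∈ X, value θ t ≤ x) ∨ ∃ z, IsLUB (A : Set (QuotientLattice θ)) z ∧ value θ t ≤ z) ∧
    ∀ y₁ y₂, y₁ ⊓ y₂ ≤ b → y₁ ≤ b ∨ y₂ ≤ b ∨
      (∃ x ∈ X, y₁ ⊓ y₂ ≤ x) ∨ ∃ z, IsLUB (A : Set (QuotientLattice θ)) z ∧ y₁ ⊓ y₂ ≤ z := by
  classical
  let N : LowerSet (QuotientLattice θ) :=
    ⟨{y | (∃ x ∈ X, y ≤ x) ∨ ∃ z, IsLUB (A : Set (QuotientLattice θ)) z ∧ y ≤ z}, by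
      rintro y y' hy (⟨x, hx, hyx⟩ | ⟨z, hz, hyz⟩)
      · exact Or.inl ⟨x, hx, hy.trans hyx⟩
      · exact Or.inr ⟨z, hz, hy.trans hyz⟩⟩
  have hmemN : ∀ y, y ∈ N ↔
      (∃ x ∈ X, y ≤ x) ∨ ∃ z, IsLUB (A : Set (QuotientLattice θ)) z ∧ y ≤ z := fun _ => Iff.rfl
  have hNb : ∀ y ∈ N, y ≤ b := by
    rintro y (⟨x, hx, hyx⟩ | ⟨z, hz, hyz⟩)
    · exact hyx.trans (hb.1 hx)
    · refine hyz.trans (hz.2 fun a ha => ?_)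
      obtain ⟨-, -, -, x, hx, hax⟩ := (hA a).1 ha
      exact hax.trans (hb.1 hx)
  -- For values of terms of `T`, the first alternative of membership in `N` implies the second.
  have hNT : ∀ t ∈ T, value θ t ∈ N →
      ∃ z, IsLUB (A : Set (QuotientLattice θ)) z ∧ value θ t ≤ z := by
    rintro t ht (⟨x, hx, htx⟩ | hz)
    · have htA : value θ t ∈ A := (hA _).2 ⟨t, ht, rfl, x, hx, htx⟩
      exact ⟨A.sup' ⟨_, htA⟩ id, Finset.isLUB_sup' _, (Finset.isLUB_sup' ⟨_, htA⟩).1 htA⟩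
    · exact hz
  obtain ⟨σ, hσ, hσP, hσT⟩ := exists_section_doubling θ hT hθ hNb (by
    intro s hs t ht hsN htN
    obtain ⟨z, hz, hsz⟩ := hNT s hs hsN
    obtain ⟨z', hz', htz⟩ := hNT t ht htN
    rw [hz'.unique hz] at htz
    exact Or.inr ⟨z, hz, sup_le hsz htz⟩)
  have hσN : ∀ y ∈ N, ¬ (σ y).IsUpper := fun y hy hu => hu.val_notMem (by rwa [hσ])
  have hσb : ¬ (σ b).IsUpper := by
    rcases X.eq_empty_or_nonempty with rfl | hX
    · have hA0 : A = ∅ := Finset.eq_empty_of_forall_notMem fun a ha => by simpa using (hA a).1 ha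
      exact hσN b (Or.inr ⟨b, hA0 ▸ hb, le_rfl⟩)
    · rw [congrArg σ (hb.unique (Finset.isLUB_sup' hX))]
      refine Finset.sup'_induction hX id (p := fun y => ¬ (σ y).IsUpper) ?_ ?_
      · intro y hy z hz
        rw [map_sup, Doubling.isUpper_sup]
        exact not_or.2 ⟨hy, hz⟩
      · exact fun x hx => hσN x (Or.inl ⟨x, hx, le_rfl⟩)
  have hlow : ∀ y ≤ b, ¬ (σ y).IsUpper := fun y hy hu => hσb ((OrderHomClass.mono σ hy).2 hu)
  refine ⟨fun t ht htb => ?_, fun y₁ y₂ hy => ?_⟩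
  · rw [← hmemN]
    by_contra hN
    refine hlow _ htb ?_
    rcases ht with ht | ⟨p, rfl⟩
    · exact (hσT t ht).2 hN
    · exact (hσP p).2 hN
  · rw [← hmemN]
    by_contra! hN
    obtain ⟨h1, h2, hN⟩ := hN
    have hu : ∀ y, ¬ y ≤ b → (σ y).IsUpper := fun y hyb => by
      by_contra hu
      exact hyb (hσ y ▸ Doubling.val_le_of_not_isUpper hu)
    refine hlow _ hy ?_
    have hmap : σ (y₁ ⊓ y₂) = σ y₁ ⊓ σ y₂ := σ.map_inf' y₁ y₂
    rw [hmap, Doubling.isUpper_inf, hσ, hσ]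
    exact ⟨hu _ h1, hu _ h2, hN⟩

theorem isLocallyCoverFinite_quotientLattice (h : IsFinitelyGeneratedCon θ) :
    IsLocallyCoverFinite (QuotientLattice θ) := by
  classical
  obtain ⟨T, hTfin, hT, hθ⟩ := h.exists_terms
  let V : Finset (QuotientLattice θ) := (hTfin.image (value θ)).toFinset
  have hV : ∀ a, a ∈ V ↔ ∃ t ∈ T, value θ t = a := fun a => by simp [V]
  -- A nontrivial join-cover of `y` is good when it is refined by one inside `G`.
  let Good : Finset (QuotientLattice θ) → QuotientLattice θ → Finset (QuotientLattice θ) → Prop :=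
    fun G y X => ∃ E ∈ nontrivialJoinCovers y, E ⊆ G ∧ Refines E X
  have hGood : ∀ {G G' y X}, G ⊆ G' → Good G y X → Good G' y X :=
    fun hG ⟨E, hE, hEG, hEX⟩ => ⟨E, hE, hEG.trans hG, hEX⟩
  have hA : ∀ (X : Finset (QuotientLattice θ)) (a : QuotientLattice θ),
      a ∈ V.filter (fun a => ∃ x ∈ X, a ≤ x) ↔
      ∃ t ∈ T, value θ t = a ∧ ∃ x ∈ X, a ≤ x := fun X a => by
    rw [Finset.mem_filter, hV]
    exact ⟨fun ⟨⟨t, ht, hta⟩, hx⟩ => ⟨t, ht, hta, hx⟩, fun ⟨t, ht, hta, hx⟩ => ⟨⟨t, ht, hta⟩, hx⟩⟩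
  have hVGood : ∀ (X : Finset (QuotientLattice θ)) (y : QuotientLattice θ), (∀ x ∈ X, ¬ y ≤ x) →
      ((∃ x ∈ X, y ≤ x) ∨ ∃ z, IsLUB ((V.filter fun a => ∃ x ∈ X, a ≤ x : Finset _) :
        Set (QuotientLattice θ)) z ∧ y ≤ z) → Good V y X := by
    rintro X y hX (⟨x, hx, hyx⟩ | hz)
    · exact (hX x hx hyx).elim
    · have href : Refines (V.filter fun a => ∃ x ∈ X, a ≤ x) X :=
        fun a ha => (Finset.mem_filter.1 ha).2
      exact ⟨_, ⟨href.forall_not_le hX, hz⟩, Finset.filter_subset _ _, href⟩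
  have hbase : ∀ t, (t ∈ T ∨ ∃ p, t = Term.var p) → ∀ X ∈ nontrivialJoinCovers (value θ t),
      Good V (value θ t) X := by
    rintro t ht X ⟨hX, b, hb, htb⟩
    exact hVGood X _ hX ((le_isLUB_cases θ hT hθ (hA X) hb).1 t ht htb)
  have hVclosed : ∀ a ∈ V, ∀ X ∈ nontrivialJoinCovers a, Good V a X := by
    intro a ha
    obtain ⟨t, ht, rfl⟩ := (hV a).1 ha
    exact hbase t (Or.inl ht)
  suffices ∀ t, ∃ G, V ⊆ G ∧ value θ t ∈ G ∧ IsCoverClosed G by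
    intro a
    obtain ⟨t, rfl⟩ := value_surjective θ a
    obtain ⟨G, -, h1, h2⟩ := this t
    exact ⟨G, h1, h2⟩
  intro t
  induction t with
  | var p =>
    refine ⟨insert (value θ (Term.var p)) V, Finset.subset_insert _ _,
      Finset.mem_insert_self _ _, fun g hg X hX => ?_⟩
    rcases Finset.mem_insert.1 hg with rfl | hg
    · exact hGood (Finset.subset_insert _ _) (hbase _ (Or.inr ⟨p, rfl⟩) X hX)
    · exact hGood (Finset.subset_insert _ _) (hVclosed g hg X hX)
  | sup s t hs ht =>
    obtain ⟨G₁, hVG₁, hsG₁, hG₁⟩ := hs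
    obtain ⟨G₂, hVG₂, htG₂, hG₂⟩ := ht
    have h1 : G₁ ⊆ insert (value θ (Term.sup s t)) (G₁ ∪ G₂) :=
      Finset.subset_union_left.trans (Finset.subset_insert _ _)
    have h2 : G₂ ⊆ insert (value θ (Term.sup s t)) (G₁ ∪ G₂) :=
      Finset.subset_union_right.trans (Finset.subset_insert _ _)
    refine ⟨_, hVG₁.trans h1, Finset.mem_insert_self _ _, fun g hg X hX => ?_⟩
    rw [Finset.mem_insert, Finset.mem_union] at hg
    rcases hg with rfl | hg | hg
    · obtain ⟨hX1, b, hb, hstb⟩ := hX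
      rw [value_sup] at hX1 hstb
      -- Each of the two joinands lies below an element of `X` or is covered nontrivially by `X`.
      have key : ∀ {G : Finset (QuotientLattice θ)} {y}, y ∈ G → IsCoverClosed G → y ≤ b →
          ∃ E ⊆ G, Refines E X ∧ ∃ z, IsLUB (E : Set (QuotientLattice θ)) z ∧ y ≤ z := by
        intro G y hy hG hyb
        by_cases hyX : ∃ x ∈ X, y ≤ x
        · exact ⟨{y}, Finset.singleton_subset_iff.2 hy,
            fun e he => by rw [Finset.mem_singleton.1 he]; exact hyX,
            y, by rw [Finset.coe_singleton]; exact isLUB_singleton, le_rfl⟩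
        · push Not at hyX
          obtain ⟨E, hE, hEG, hEX⟩ := hG y hy X ⟨hyX, b, hb, hyb⟩
          exact ⟨E, hEG, hEX, hE.2⟩
      obtain ⟨E₁, hE₁, hr₁, z₁, hz₁, hsz⟩ := key hsG₁ hG₁ (le_sup_left.trans hstb)
      obtain ⟨E₂, hE₂, hr₂, z₂, hz₂, htz⟩ := key htG₂ hG₂ (le_sup_right.trans hstb)
      have href : Refines (E₁ ∪ E₂) X := fun e he => (Finset.mem_union.1 he).elim (hr₁ e) (hr₂ e)
      refine ⟨E₁ ∪ E₂, ⟨href.forall_not_le hX1, z₁ ⊔ z₂, ?_, sup_le_sup hsz htz⟩,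
        (Finset.union_subset_union hE₁ hE₂).trans (Finset.subset_insert _ _), href⟩
      rw [Finset.coe_union]
      exact hz₁.union hz₂
    · exact hGood h1 (hG₁ g hg X hX)
    · exact hGood h2 (hG₂ g hg X hX)
  | inf s t hs ht =>
    obtain ⟨G₁, hVG₁, hsG₁, hG₁⟩ := hs
    obtain ⟨G₂, hVG₂, htG₂, hG₂⟩ := ht
    have h1 : G₁ ⊆ insert (value θ (Term.inf s t)) (G₁ ∪ G₂) :=
      Finset.subset_union_left.trans (Finset.subset_insert _ _)
    have h2 : G₂ ⊆ insert (value θ (Term.inf s t)) (G₁ ∪ G₂) :=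
      Finset.subset_union_right.trans (Finset.subset_insert _ _)
    refine ⟨_, hVG₁.trans h1, Finset.mem_insert_self _ _, fun g hg X hX => ?_⟩
    rw [Finset.mem_insert, Finset.mem_union] at hg
    rcases hg with rfl | hg | hg
    · obtain ⟨hX1, b, hb, hstb⟩ := hX
      rw [value_inf] at hX1 hstb
      -- A join-cover of a meetand covers the meet.
      have key : ∀ {G : Finset (QuotientLattice θ)} {y}, y ∈ G → IsCoverClosed G → y ≤ b →
          value θ s ⊓ value θ t ≤ y → Good G (value θ s ⊓ value θ t) X := by
        intro G y hy hG hyb hsty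
        obtain ⟨E, ⟨-, z, hz, hyz⟩, hEG, hEX⟩ :=
          hG y hy X ⟨fun x hx hyx => hX1 x hx (hsty.trans hyx), b, hb, hyb⟩
        exact ⟨E, ⟨hEX.forall_not_le hX1, z, hz, hsty.trans hyz⟩, hEG, hEX⟩
      rcases (le_isLUB_cases θ hT hθ (hA X) hb).2 _ _ hstb with hsb | htb | hN
      · exact hGood h1 (key hsG₁ hG₁ hsb inf_le_left)
      · exact hGood h2 (key htG₂ hG₂ htb inf_le_right)
      · exact hGood (hVG₁.trans h1) (hVGood X _ hX1 hN)
    · exact hGood h1 (hG₁ g hg X hX)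
    · exact hGood h2 (hG₂ g hg X hX)

end FinitelyGenerated

end LatticeTheory

theorem corollaryC :
    -- quotients of free lattices on posets by finitely generated congruences
    (∀ (P : Type u) [PartialOrder P] (θ : LatticeCon (LatticeTheory.FreeLattice P)),
      LatticeTheory.IsFinitelyGeneratedCon θ →
        LatticeTheory.HasMCRP (LatticeTheory.QuotientLattice θ)) ∧
    -- lower bounded homomorphic images of finitely defined lattices
    (∀ (M : Type w) (L : Type v) [Lattice M] [Lattice L] (f : LatticeHom M L),
      LatticeTheory.IsFinitelyDefined.{w, u} M → Function.Surjective f →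
        LatticeTheory.IsLowerBoundedHom f →
          LatticeTheory.IsBialgebraic (LatticeTheory.Id L) ∧
          ((∃ z : L, IsBot z) → LatticeTheory.IsBialgebraic (Order.Ideal L))) := by
  refine ⟨fun P _ θ hθ => (LatticeTheory.isLocallyCoverFinite_quotientLattice θ hθ).hasMCRP,
    fun M L _ _ f hM hf hfb => ?_⟩
  obtain ⟨X, θ, hθ, ⟨e⟩⟩ := hM
  have hL : LatticeTheory.IsLocallyCoverFinite L := by
    have he : Function.Surjective (f ∘ e.symm) := hf.comp e.symm.surjective
    refine LatticeTheory.isLocallyCoverFinite_of_lowerBounded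
      (f.comp (e.symm : LatticeHom (LatticeTheory.QuotientLattice θ) M)) he (fun a => ?_)
      (LatticeTheory.isLocallyCoverFinite_quotientLattice θ hθ)
    refine (hfb a).imp (fun h0 => ?_) fun ⟨x, hx⟩ => ⟨e x, ?_, fun y hy => ?_⟩
    · exact Set.eq_empty_of_forall_notMem fun y hy =>
        (h0 ▸ (hy : e.symm y ∈ f ⁻¹' Set.Ici a) : e.symm y ∈ (∅ : Set M))
    · change a ≤ f (e.symm (e x))
      rw [e.symm_apply_apply]
      exact hx.1
    · exact e.le_symm_apply.1 (hx.2 hy)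
  exact ⟨(LatticeTheory.isIdealFamily_id L).isBialgebraic hL,
    fun ⟨_, hz⟩ => (LatticeTheory.isIdealFamily_orderIdeal hz).isBialgebraic hL⟩
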